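/- Let $\mathbb D=\{z\in\mathbb C:|z|<1\}$, let $2<p\le\infty$ (with $2/p=0$ if $p=\infty$) and let $N\ge 0$. Then there exists a real constant $c$, depending only on $p$ and $N$, with the following property. Let $f:\mathbb D\to\mathbb C$ be a continuous function without zeros such that $|f|<1/e$ on $\mathbb D$ and such that the derivative $f_{\bar z}=\partial f/\partial\bar z=\tfrac12(\partial f/\partial x+i\,\partial f/\partial y)$ in the sense of distributions is (represented by) a locally integrable function on $\mathbb D$. Suppose that $$|f_{\bar z}|\le A\,|f|\,\log\frac1{|f|}\quad\text{almost everywhere in }\mathbb D,$$ where $A\in L^p(\mathbb D)$ (with respect to area measure) and $\|A\|_{L^p(\mathbb D)}=N$. Then, for every $z\in\mathbb D$, $$e^{-c/(1-|z|)^{2-2/p}}\;\le\;\frac{\log (1/|f(z)|)}{\log (1/|f(0)|)}\;\le\;e^{c/(1-|z|)} .$$ -/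

import Mathlib

open MeasureTheory
open scoped NNReal ENNReal

/-- The Cauchy–Riemann derivative `∂φ/∂z̄ = (1/2) (∂φ/∂x + i ∂φ/∂y)` of a real-differentiable
function `φ : ℂ → ℂ`. -/
noncomputable def dbar (φ : ℂ → ℂ) (z : ℂ) : ℂ :=
  (1 / 2 : ℂ) * (fderiv ℝ φ z 1 + Complex.I * fderiv ℝ φ z Complex.I)

/-- `g` is locally integrable on the open set `U` and is the derivative `∂f/∂z̄` of the locally
integrable function `f` on `U` in the sense of distributions: it satisfies
`∫ f ∂φ/∂z̄ = - ∫ g φ` (area integrals) for every smooth `φ` with compact support in `U`. -/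
structure HasDistribDbarOn (f g : ℂ → ℂ) (U : Set ℂ) : Prop where
  locallyIntegrableOn_fun : LocallyIntegrableOn f U volume
  locallyIntegrableOn_deriv : LocallyIntegrableOn g U volume
  integral_eq : ∀ φ : ℂ → ℂ, ContDiff ℝ (⊤ : ℕ∞) φ → HasCompactSupport φ → tsupport φ ⊆ U →
    ∫ z in U, f z * dbar φ z = - ∫ z in U, g z * φ z

/-! For smooth `f`, choose a branch `l` of `log f`. Since `-l` has positive real part, `w = log
(-l)` is well defined with `|Im w| ≤ π/2`. From `f = exp (-exp w)` one gets `dbar f = f * l * dbar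
w`, and `|l| ≥ log (1/|f|)`, so the hypothesis becomes the linear bound `|dbar w| ≤ |A|`. Because `p
> 2`, the conjugate exponent is below 2 and Hölder bounds the Cauchy potential of `|A|`
(`exists_lintegral_mul_inv_le`). Subtracting from `w` the Cauchy transform of a cut-off of `dbar w`
leaves a holomorphic function with bounded imaginary part, and Borel–Carathéodory controls its
oscillation (`norm_sub_le_of_abs_im_le`). As `Re w = log |l|`, this compares `|l z|` with `|l 0|` in
both directions. Passing from `|l|` to `log (1/|f|)` costs a factor `1 + π`, thanks to `|f| < 1/e`
and a normalised branch (`log_inv_norm_le_of_dbar_le`). For general `f` the argument is applied to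
mollifications on smaller discs: they satisfy the same inequality with `A` replaced by twice a
mollification of `|A|`, whose potential is no worse than doubled (`exists_approx_log_inv_norm_le`).
The resulting lower bound has exponent 1, stronger than the required `2 - 2/p`. -/

/-! ### The Cauchy–Pompeiu formula and the Cauchy transform. -/

open Complex Set Filter Topology in
theorem locallyIntegrable_inv_complex : LocallyIntegrable (fun ζ : ℂ => ζ⁻¹) volume := by
  refine locallyIntegrable_of_norm_le_rpow (C := 1) (α := 1) (by simp) (by simp) ?_
    (measurable_inv.aestronglyMeasurable)
  filter_upwards with x
  simp [Real.rpow_neg_one]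

/-- Needed for polar coordinates: with `e = exp (iθ)` the right side involves only the radial and
angular derivatives. -/
theorem mul_dbar_eq (g : ℂ → ℂ) (z e : ℂ) (he : ‖e‖ = 1) :
    e⁻¹ * dbar g z =
      (1 / 2 : ℂ) * (fderiv ℝ g z e + Complex.I * fderiv ℝ g z (Complex.I * e)) := by
  have key : ∀ v : ℂ, fderiv ℝ g z v = v.re * fderiv ℝ g z 1 + v.im * fderiv ℝ g z Complex.I := by
    intro v
    conv_lhs => rw [show v = v.re • (1 : ℂ) + v.im • Complex.I by
      simp [Complex.re_add_im]]
    rw [map_add, map_smul, map_smul]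
    simp
  rw [key e, key (Complex.I * e), Complex.inv_def]
  have hn : Complex.normSq e = 1 := by rw [Complex.normSq_eq_norm_sq, he]; norm_num
  rw [hn, dbar]
  have hc : (starRingEnd ℂ) e = e.re - e.im * Complex.I := by
    apply Complex.ext <;> simp
  rw [hc]
  simp only [Complex.mul_re, Complex.I_re, Complex.I_im, Complex.mul_im]
  push_cast
  linear_combination (1 / 2 : ℂ) * (e.im * fderiv ℝ g z Complex.I) * (-Complex.I_sq)

-- In polar coordinates the Jacobian `r` cancels the singularity of `1/ζ`. The radial derivative
-- integrates to `-g 0` along each ray, and the angular one to zero around each circle.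
open Complex Set Filter Topology in
theorem integral_inv_mul_dbar {g : ℂ → ℂ} (hg : ContDiff ℝ 1 g) (hc : HasCompactSupport g) :
    ∫ ζ : ℂ, ζ⁻¹ * dbar g ζ = - (Real.pi * g 0) := by
  obtain ⟨R, hR0, hR⟩ := hc.isCompact.isBounded.exists_pos_norm_lt
  have hzero : ∀ x : ℂ, R ≤ ‖x‖ → fderiv ℝ g x = 0 := by
    intro x hx
    have : x ∉ tsupport g := fun h => absurd (hR x h) (not_lt.2 hx)
    exact image_eq_zero_of_notMem_tsupport (fun h => this (tsupport_fderiv_subset ℝ h))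
  have hcf : Continuous (fderiv ℝ g) := hg.continuous_fderiv one_ne_zero
  have hdiff : Differentiable ℝ g := hg.differentiable one_ne_zero
  set e : ℝ → ℂ := fun θ => exp (θ * I) with he
  have hen : ∀ θ, ‖e θ‖ = 1 := fun θ => norm_exp_ofReal_mul_I θ
  have hec : Continuous e := by fun_prop
  set F₁ : ℝ × ℝ → ℂ := fun p => fderiv ℝ g (p.1 * e p.2) (e p.2) with hF₁
  set F₂ : ℝ × ℝ → ℂ := fun p => fderiv ℝ g (p.1 * e p.2) (I * e p.2) with hF₂
  have hF₁c : Continuous F₁ := by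
    apply Continuous.clm_apply <;> fun_prop
  have hF₂c : Continuous F₂ := by
    apply Continuous.clm_apply <;> fun_prop
  have hint : ∀ F : ℝ × ℝ → ℂ, Continuous F → (∀ p : ℝ × ℝ, R ≤ p.1 → F p = 0) →
      IntegrableOn F (Ioi 0 ×ˢ Ioo (-Real.pi) Real.pi) (volume.prod volume) := by
    intro F hF h0
    have h1 : IntegrableOn F (Icc 0 R ×ˢ Icc (-Real.pi) Real.pi) (volume.prod volume) :=
      hF.continuousOn.integrableOn_compact (isCompact_Icc.prod isCompact_Icc)
    refine h1.of_forall_sdiff_eq_zero (measurableSet_Ioi.prod measurableSet_Ioo) ?_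
    rintro ⟨r, θ⟩ ⟨⟨hr, hθ⟩, h2⟩
    apply h0
    by_contra h
    exact h2 ⟨⟨le_of_lt hr, le_of_lt (not_le.1 h)⟩, Ioo_subset_Icc_self hθ⟩
  have hnr : ∀ p : ℝ × ℝ, R ≤ p.1 → R ≤ ‖(p.1 : ℂ) * e p.2‖ := by
    intro p hp
    rw [norm_mul, hen, mul_one, norm_real, Real.norm_eq_abs]
    exact hp.trans (le_abs_self _)
  have hI₁ := hint F₁ hF₁c (fun p hp => by simp [hF₁, hzero _ (hnr p hp)])
  have hI₂ := hint F₂ hF₂c (fun p hp => by simp [hF₂, hzero _ (hnr p hp)])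
  have hpolar : ∫ ζ : ℂ, ζ⁻¹ * dbar g ζ =
      ∫ p in Ioi (0 : ℝ) ×ˢ Ioo (-Real.pi) Real.pi, (1 / 2 : ℂ) * (F₁ p + I * F₂ p) := by
    rw [← Complex.integral_comp_polarCoord_symm]
    refine setIntegral_congr_fun (measurableSet_Ioi.prod measurableSet_Ioo) ?_
    rintro ⟨r, θ⟩ ⟨hr, -⟩
    have hr' : (r : ℂ) ≠ 0 := by exact_mod_cast (ne_of_gt hr)
    have : Complex.polarCoord.symm (r, θ) = r * e θ := by
      rw [Complex.polarCoord_symm_apply, he]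
      simp [exp_mul_I]
    simp only [this]
    rw [← mul_dbar_eq g _ _ (hen θ), mul_inv, real_smul]
    field_simp
  have h₁ : ∫ p in Ioi (0 : ℝ) ×ˢ Ioo (-Real.pi) Real.pi, F₁ p ∂(volume.prod volume)
      = -(2 * Real.pi * g 0) := by
    rw [← Measure.prod_restrict]
    rw [integral_prod_symm _ (by simpa [IntegrableOn, Measure.prod_restrict] using hI₁)]
    have : ∀ θ : ℝ, ∫ r in Ioi (0 : ℝ), F₁ (r, θ) = - g 0 := by
      intro θ
      have hd : ∀ r : ℝ, HasDerivAt (fun r : ℝ => g (r * e θ)) (F₁ (r, θ)) r := by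
        intro r
        have h1 : HasDerivAt (fun r : ℝ => (r : ℂ) * e θ) (e θ) r := by
          simpa using (hasDerivAt_id r).ofReal_comp.mul_const (e θ)
        exact (hdiff _).hasFDerivAt.comp_hasDerivAt r h1
      have hcs : HasCompactSupport (fun r : ℝ => g (r * e θ)) := by
        refine HasCompactSupport.intro (isCompact_Icc (a := -R) (b := R)) ?_
        intro r hr
        apply image_eq_zero_of_notMem_tsupport
        intro h
        have := hR _ h
        rw [norm_mul, hen, mul_one, norm_real, Real.norm_eq_abs, abs_lt] at this
        exact hr ⟨this.1.le, this.2.le⟩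
      have hcd : ContDiff ℝ 1 (fun r : ℝ => g (r * e θ)) :=
        hg.comp ((ofRealCLM.contDiff).mul contDiff_const)
      have := hcs.integral_Ioi_deriv_eq hcd 0
      simp only [fun r => (hd r).deriv] at this
      simpa using this
    simp only [this]
    simp [Real.pi_pos.le, two_mul]
  have h₂ : ∫ p in Ioi (0 : ℝ) ×ˢ Ioo (-Real.pi) Real.pi, F₂ p ∂(volume.prod volume) = 0 := by
    rw [setIntegral_prod _ hI₂]
    rw [setIntegral_eq_zero_of_forall_eq_zero]
    intro r hr
    have hr' : (r : ℂ) ≠ 0 := by exact_mod_cast (ne_of_gt hr)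
    have hd : ∀ θ : ℝ, HasDerivAt (fun θ : ℝ => g (r * e θ)) (r * F₂ (r, θ)) θ := by
      intro θ
      have h1 : HasDerivAt (fun θ : ℝ => (r : ℂ) * e θ) (r • (I * e θ)) θ := by
        have h2 : HasDerivAt (fun θ : ℝ => (θ : ℂ) * I) I θ := by
          simpa using (hasDerivAt_id θ).ofReal_comp.mul_const I
        have := (h2.cexp).const_mul (r : ℂ)
        refine this.congr_deriv ?_
        simp only [he, real_smul]; ring
      have := (hdiff _).hasFDerivAt.comp_hasDerivAt θ h1
      rw [map_smul, real_smul] at this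
      exact this
    rw [← integral_Ioc_eq_integral_Ioo, ← intervalIntegral.integral_of_le (by linarith [Real.pi_pos])]
    have := intervalIntegral.integral_eq_sub_of_hasDerivAt (a := -Real.pi) (b := Real.pi)
      (fun θ _ => hd θ) (Continuous.intervalIntegrable (by fun_prop) _ _)
    rw [intervalIntegral.integral_const_mul] at this
    have h3 : e Real.pi = e (-Real.pi) := by simp [he, exp_neg, exp_pi_mul_I]
    rw [h3, sub_self] at this
    exact (mul_eq_zero.1 this).resolve_left hr'
  rw [hpolar, integral_const_mul]
  have : ∫ p in Ioi (0 : ℝ) ×ˢ Ioo (-Real.pi) Real.pi, (F₁ p + I * F₂ p) =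
      (∫ p in Ioi (0 : ℝ) ×ˢ Ioo (-Real.pi) Real.pi, F₁ p) +
       I * ∫ p in Ioi (0 : ℝ) ×ˢ Ioo (-Real.pi) Real.pi, F₂ p := by
    rw [← integral_const_mul]
    exact integral_add hI₁ (hI₂.const_mul I)
  rw [this]
  change (1 / 2 : ℂ) * ((∫ p in Ioi (0 : ℝ) ×ˢ Ioo (-Real.pi) Real.pi, F₁ p ∂(volume.prod volume)) +
    I * ∫ p in Ioi (0 : ℝ) ×ˢ Ioo (-Real.pi) Real.pi, F₂ p ∂(volume.prod volume)) = _
  rw [h₁, h₂]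
  ring

open scoped Convolution in
theorem dbar_convolution {k g : ℂ → ℂ} (hk : LocallyIntegrable k volume) (hg : ContDiff ℝ 1 g)
    (hc : HasCompactSupport g) (z : ℂ) :
    dbar (k ⋆[ContinuousLinearMap.mul ℝ ℂ, volume] g) z = ∫ t : ℂ, k t * dbar g (z - t) := by
  have h := hc.hasFDerivAt_convolution_right (ContinuousLinearMap.mul ℝ ℂ) hk hg z
  have hcf : Continuous (fderiv ℝ g) := hg.continuous_fderiv one_ne_zero
  have happ : ∀ v, fderiv ℝ (k ⋆[ContinuousLinearMap.mul ℝ ℂ, volume] g) z v =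
      ∫ t : ℂ, k t * fderiv ℝ g (z - t) v := by
    intro v
    rw [h.fderiv, convolution_precompR_apply _ hk (hc.fderiv ℝ) hcf]
    rfl
  have hint : ∀ v, Integrable (fun t : ℂ => k t * fderiv ℝ g (z - t) v) := by
    intro v
    have hcs : HasCompactSupport (fun t => fderiv ℝ g t v) := hc.fderiv_apply ℝ v
    exact hcs.convolutionExists_right (ContinuousLinearMap.mul ℝ ℂ) hk (by fun_prop) z
  rw [dbar, happ, happ, ← integral_const_mul, ← integral_add (hint 1) ((hint Complex.I).const_mul _),
    ← integral_const_mul]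
  congr 1
  funext t
  simp only [dbar]
  ring

open scoped Convolution in
/-- The Cauchy transform `z ↦ (1/π) ∫ g(z - ζ) / ζ dA(ζ)`. -/
noncomputable def cauchyTransform (g : ℂ → ℂ) : ℂ → ℂ :=
  (fun ζ : ℂ => (Real.pi : ℂ)⁻¹ * ζ⁻¹) ⋆[ContinuousLinearMap.mul ℝ ℂ, volume] g

theorem cauchyTransform_apply (g : ℂ → ℂ) (z : ℂ) :
    cauchyTransform g z = (Real.pi : ℂ)⁻¹ * ∫ ζ : ℂ, ζ⁻¹ * g (z - ζ) := by
  simp only [cauchyTransform, MeasureTheory.convolution, ContinuousLinearMap.mul_apply', mul_assoc]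
  rw [integral_const_mul]

theorem dbar_comp_sub_left {g : ℂ → ℂ} (hg : Differentiable ℝ g) (z t : ℂ) :
    dbar (fun t => g (z - t)) t = - dbar g (z - t) := by
  have : HasFDerivAt (fun t => g (z - t)) (-(fderiv ℝ g (z - t))) t := by
    have h1 : HasFDerivAt (fun t : ℂ => z - t) (-(ContinuousLinearMap.id ℝ ℂ)) t :=
      (hasFDerivAt_id t).const_sub z
    refine ((hg (z - t)).hasFDerivAt.comp t h1).congr_fderiv ?_
    ext; simp
  simp only [dbar, this.fderiv]
  simp
  ring

theorem cauchyTransform_dbar {g : ℂ → ℂ} (hg : ContDiff ℝ 1 g) (hc : HasCompactSupport g) (z : ℂ) :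
    cauchyTransform (dbar g) z = g z := by
  have h := integral_inv_mul_dbar (g := fun t => g (z - t)) (hg.comp (contDiff_const.sub contDiff_id))
    (hc.comp_homeomorph (Homeomorph.subLeft z))
  simp only [dbar_comp_sub_left (hg.differentiable one_ne_zero), mul_neg, integral_neg, neg_inj,
    sub_zero] at h
  rw [cauchyTransform_apply, h, ← mul_assoc, inv_mul_cancel₀ (by exact_mod_cast Real.pi_ne_zero),
    one_mul]

theorem locallyIntegrable_cauchyKernel :
    LocallyIntegrable (fun ζ : ℂ => (Real.pi : ℂ)⁻¹ * ζ⁻¹) volume :=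
  locallyIntegrable_inv_complex.smul (Real.pi : ℂ)⁻¹

theorem differentiable_cauchyTransform {g : ℂ → ℂ} (hg : ContDiff ℝ 1 g)
    (hc : HasCompactSupport g) : Differentiable ℝ (cauchyTransform g) := fun z =>
  (hc.hasFDerivAt_convolution_right (ContinuousLinearMap.mul ℝ ℂ) locallyIntegrable_cauchyKernel
    hg z).differentiableAt

/-- Convolution lets `dbar` fall on `g`, so this reduces to the Cauchy–Pompeiu formula
`cauchyTransform_dbar`. -/
theorem dbar_cauchyTransform {g : ℂ → ℂ} (hg : ContDiff ℝ 1 g) (hc : HasCompactSupport g) (z : ℂ) :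
    dbar (cauchyTransform g) z = g z := by
  rw [← cauchyTransform_dbar hg hc z, cauchyTransform,
    dbar_convolution locallyIntegrable_cauchyKernel hg hc, cauchyTransform_apply,
    ← integral_const_mul]
  simp only [mul_assoc]

theorem enorm_cauchyTransform_le (g : ℂ → ℂ) (z : ℂ) :
    ‖cauchyTransform g z‖ₑ ≤ ∫⁻ ζ, ‖g ζ‖ₑ * ‖ζ - z‖ₑ⁻¹ := by
  rw [cauchyTransform_apply, enorm_mul]
  have h1 : ‖(Real.pi : ℂ)⁻¹‖ₑ ≤ 1 := by
    rw [← ofReal_norm, norm_inv, Complex.norm_real, Real.norm_of_nonneg Real.pi_pos.le]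
    exact ENNReal.ofReal_le_one.2 (inv_le_one_of_one_le₀ (by linarith [Real.pi_gt_three]))
  calc _ ≤ 1 * ∫⁻ ζ : ℂ, ‖ζ⁻¹ * g (z - ζ)‖ₑ := by
        gcongr
        exact enorm_integral_le_lintegral_enorm _
    _ = ∫⁻ ζ : ℂ, ‖(z - ζ)⁻¹ * g ζ‖ₑ := by
        rw [one_mul, ← lintegral_sub_left_eq_self _ z]
        simp
    _ ≤ _ := by
        refine lintegral_mono_ae ?_
        filter_upwards [Measure.ae_ne volume z] with ζ hζ
        rw [enorm_mul, enorm_inv (sub_ne_zero.2 hζ.symm), mul_comm, ← enorm_neg (z - ζ), neg_sub]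

/-! ### Calculus of `dbar` and the oscillation estimate. -/

theorem dbar_congr_of_eventuallyEq {f g : ℂ → ℂ} {z : ℂ} (h : f =ᶠ[nhds z] g) :
    dbar f z = dbar g z := by
  simp only [dbar, h.fderiv_eq]

theorem dbar_sub {f g : ℂ → ℂ} {z : ℂ} (hf : DifferentiableAt ℝ f z)
    (hg : DifferentiableAt ℝ g z) :
    dbar (fun ζ => f ζ - g ζ) z = dbar f z - dbar g z := by
  simp only [dbar, fderiv_fun_sub hf hg, sub_apply]
  ring

theorem dbar_holomorphic_comp {φ F : ℂ → ℂ} {φ' z : ℂ} (hφ : HasDerivAt φ φ' (F z))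
    (hF : DifferentiableAt ℝ F z) : dbar (fun ζ => φ (F ζ)) z = φ' * dbar F z := by
  have h : HasFDerivAt (fun ζ => φ (F ζ)) _ z :=
    (hφ.hasFDerivAt.restrictScalars ℝ).comp z hF.hasFDerivAt
  simp only [dbar, h.fderiv]
  simp
  ring

theorem differentiableAt_complex_of_dbar_eq_zero {h : ℂ → ℂ} {z : ℂ}
    (hd : DifferentiableAt ℝ h z) (h0 : dbar h z = 0) : DifferentiableAt ℂ h z := by
  rw [differentiableAt_complex_iff_differentiableAt_real]
  refine ⟨hd, ?_⟩
  have h1 : fderiv ℝ h z 1 + Complex.I * fderiv ℝ h z Complex.I = 0 := by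
    simpa [dbar] using h0
  rw [smul_eq_mul]
  linear_combination (-Complex.I) * h1 + fderiv ℝ h z Complex.I * Complex.I_sq

open Metric in
/-- A function with bounded imaginary part on a disc, whose `∂/∂z̄`-derivative is dominated by a
function with bounded Cauchy potential, has controlled oscillation. -/
theorem norm_sub_le_of_abs_im_le {w : ℂ → ℂ} {R M K : ℝ} {B : ℂ → ℝ≥0∞}
    (hM : 0 < M) (hK : 0 ≤ K) (hw : ContDiffOn ℝ 2 w (ball 0 R))
    (him : ∀ z ∈ ball (0 : ℂ) R, |(w z).im| ≤ M)
    (hB : ∀ z ∈ ball (0 : ℂ) R, ‖dbar w z‖ₑ ≤ B z)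
    (hpot : ∀ z ∈ ball (0 : ℂ) R, ∫⁻ ζ in ball (0 : ℂ) R, B ζ * ‖ζ - z‖ₑ⁻¹ ≤ ENNReal.ofReal K)
    {z : ℂ} (hz : z ∈ ball (0 : ℂ) R) :
    ‖w z - w 0‖ ≤ 8 * (M + K) * ‖z‖ / (R - ‖z‖) + 2 * K := by
  have hzR : ‖z‖ < R := by simpa using hz
  have hR : 0 < R := (norm_nonneg z).trans_lt hzR
  -- The midpoint leaves room for a cutoff equal to 1 near `z` and supported inside the large disc;
  -- halving `R - ‖z‖` turns the factor 4 of Borel–Carathéodory below into 8.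
  set R₁ : ℝ := (R + ‖z‖) / 2 with hR₁
  have h1 : ‖z‖ < R₁ := by linarith
  have h2 : R₁ < R := by linarith
  have h0R : 0 < R₁ := by positivity
  let χ : ContDiffBump (0 : ℂ) := ⟨R₁, (R₁ + R) / 2, h0R, by linarith⟩
  set g : ℂ → ℂ := fun ζ => χ ζ • dbar w ζ with hg
  have hsupp : ∀ ζ, ζ ∉ ball (0 : ℂ) R → ζ ∉ tsupport (χ : ℂ → ℝ) := by
    intro ζ hζ h
    rw [χ.tsupport_eq] at h
    have : ‖ζ‖ ≤ (R₁ + R) / 2 := by simpa [χ] using h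
    exact hζ (by rw [mem_ball_zero_iff]; linarith)
  have hwat : ∀ ζ ∈ ball (0 : ℂ) R, ContDiffAt ℝ 2 w ζ := fun ζ hζ =>
    hw.contDiffAt (isOpen_ball.mem_nhds hζ)
  have hgc : ContDiff ℝ 1 g := by
    rw [contDiff_iff_contDiffAt]
    intro ζ
    by_cases hζ : ζ ∈ ball (0 : ℂ) R
    · have hf : ContDiffAt ℝ 1 (fderiv ℝ w) ζ := (hwat ζ hζ).fderiv_right (by norm_num)
      refine (χ.contDiff.contDiffAt).smul ?_
      unfold dbar
      exact contDiffAt_const.mul ((hf.clm_apply contDiffAt_const).add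
        (contDiffAt_const.mul (hf.clm_apply contDiffAt_const)))
    · have : g =ᶠ[nhds ζ] fun _ => 0 := by
        filter_upwards [notMem_tsupport_iff_eventuallyEq.1 (hsupp ζ hζ)] with x hx
        simp [hg, hx]
      exact contDiffAt_const.congr_of_eventuallyEq this
  have hgs : HasCompactSupport g := χ.hasCompactSupport.smul_right
  have hT : ∀ ζ ∈ ball (0 : ℂ) R, ‖cauchyTransform g ζ‖ ≤ K := by
    intro ζ hζ
    have h := enorm_cauchyTransform_le g ζ
    have h3 : ∫⁻ x, ‖g x‖ₑ * ‖x - ζ‖ₑ⁻¹ ≤ ∫⁻ x in ball (0 : ℂ) R, B x * ‖x - ζ‖ₑ⁻¹ := by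
      rw [← lintegral_indicator measurableSet_ball]
      refine lintegral_mono fun x => ?_
      by_cases hx : x ∈ ball (0 : ℂ) R
      · rw [Set.indicator_of_mem hx]
        gcongr
        refine le_trans ?_ (hB x hx)
        rw [hg, enorm_smul]
        refine mul_le_of_le_one_left' ?_
        rw [← ofReal_norm, Real.norm_of_nonneg χ.nonneg]
        exact ENNReal.ofReal_le_one.2 χ.le_one
      · have : χ x = 0 := image_eq_zero_of_notMem_tsupport (hsupp x hx)
        simp [hg, this]
    have h4 := (h.trans h3).trans (hpot ζ hζ)
    rw [← ofReal_norm] at h4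
    exact (ENNReal.ofReal_le_ofReal_iff hK).1 h4
  set h : ℂ → ℂ := fun ζ => w ζ - cauchyTransform g ζ with hh
  have hsub : ball (0 : ℂ) R₁ ⊆ ball 0 R := ball_subset_ball h2.le
  have hd : DifferentiableOn ℂ h (ball 0 R₁) := by
    intro ζ hζ
    have hwd : DifferentiableAt ℝ w ζ := (hwat ζ (hsub hζ)).differentiableAt two_ne_zero
    have hTd := differentiable_cauchyTransform hgc hgs ζ
    refine (differentiableAt_complex_of_dbar_eq_zero (hwd.sub hTd) ?_).differentiableWithinAt
    have h5 := dbar_sub hwd hTd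
    have h6 : χ ζ = 1 := χ.one_of_mem_closedBall (ball_subset_closedBall hζ)
    have h9 : g ζ = dbar w ζ := by simp [hg, h6]
    rw [dbar_cauchyTransform hgc hgs, h9, sub_self] at h5
    exact h5
  have him' : ∀ ζ ∈ ball (0 : ℂ) R, |(h ζ).im| ≤ M + K := by
    intro ζ hζ
    rw [hh, Complex.sub_im]
    exact (abs_sub _ _).trans
      (add_le_add (him ζ hζ) ((Complex.abs_im_le_norm _).trans (hT ζ hζ)))
  have h00 : (0 : ℂ) ∈ ball (0 : ℂ) R := by simpa using hR
  -- Multiplying by `-i` turns the bound on the imaginary part into the one-sided bound on the real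
  -- part required here.
  have hBC := Complex.borelCaratheodory_zero (f := fun ζ => -Complex.I * (h ζ - h 0))
    (M := 2 * (M + K)) (R := R₁) (z := z) (by positivity)
    ((hd.sub_const _).const_mul _)
    (by
      intro ζ hζ
      have e1 := abs_le.1 (him' ζ (hsub hζ))
      have e2 := abs_le.1 (him' 0 h00)
      simp only [Set.mem_ofPred_eq, Complex.mul_re, Complex.neg_re, Complex.neg_im, Complex.I_re,
        Complex.I_im, Complex.sub_im]
      linarith)
    h0R (by simpa using h1) (by simp)
  have h7 : ‖h z - h 0‖ ≤ 8 * (M + K) * ‖z‖ / (R - ‖z‖) := by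
    rw [norm_mul, norm_neg, Complex.norm_I, one_mul] at hBC
    refine hBC.trans (le_of_eq ?_)
    rw [show R₁ - ‖z‖ = (R - ‖z‖) / 2 by rw [hR₁]; ring]
    have : R - ‖z‖ ≠ 0 := by linarith
    field_simp
    ring
  have h8 : w z - w 0 = (h z - h 0) + (cauchyTransform g z - cauchyTransform g 0) := by
    simp only [hh]; ring
  rw [h8]
  refine (norm_add_le _ _).trans (add_le_add h7 ((norm_sub_le _ _).trans ?_))
  linarith [hT z hz, hT 0 h00]

/-! ### Logarithms of zero-free functions and the estimate for smooth functions. -/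

-- Continuity keeps `l ζ - l z` in the strip `|Im| < π`, so locally `l` is the principal logarithm
-- of `g ζ / g z` plus a constant.
open Metric in
theorem contDiffAt_of_exp_comp {l g : ℂ → ℂ} {z : ℂ} {n : WithTop ℕ∞} (hl : ContinuousAt l z)
    (hlg : ∀ᶠ ζ in nhds z, Complex.exp (l ζ) = g ζ) (hg : ContDiffAt ℝ n g z) :
    ContDiffAt ℝ n l z := by
  have hz : Complex.exp (l z) = g z := hlg.self_of_nhds
  have hne : g z ≠ 0 := hz ▸ Complex.exp_ne_zero _
  have h1 : ContDiffAt ℝ n (fun ζ => Complex.log (g ζ / g z) + l z) z := by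
    refine ContDiffAt.add ?_ contDiffAt_const
    have h2 : ContDiffAt ℝ n Complex.log (g z / g z) :=
      (Complex.contDiffAt_log (by rw [div_self hne]; simp)).restrict_scalars ℝ
    refine ContDiffAt.comp (g := Complex.log) (f := fun ζ => g ζ / g z) z h2 ?_
    simpa [div_eq_mul_inv] using hg.mul contDiffAt_const
  refine h1.congr_of_eventuallyEq ?_
  have h3 : ∀ᶠ ζ in nhds z, l ζ ∈ ball (l z) Real.pi := hl (ball_mem_nhds _ Real.pi_pos)
  filter_upwards [hlg, h3] with ζ h4 h5
  rw [← h4, ← hz, ← Complex.exp_sub]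
  have h6 : |(l ζ - l z).im| < Real.pi :=
    (Complex.abs_im_le_norm _).trans_lt (by simpa [dist_eq_norm] using h5)
  rw [abs_lt] at h6
  rw [Complex.log_exp h6.1 h6.2.le]
  ring

open Metric in
theorem exists_log_branch {g : ℂ → ℂ} {R : ℝ} (hg : ContinuousOn g (ball 0 R))
    (h0 : ∀ z ∈ ball (0 : ℂ) R, g z ≠ 0) {x : ℂ} (hx : x ∈ ball (0 : ℂ) R) :
    ∃ l : ℂ → ℂ, ContinuousOn l (ball 0 R) ∧ (∀ z ∈ ball (0 : ℂ) R, Complex.exp (l z) = g z) ∧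
      |(l x).im| ≤ Real.pi := by
  have hsc : IsSimplyConnected (ball (0 : ℂ) R) := by
    have := (convex_ball (0 : ℂ) R).contractibleSpace ⟨x, hx⟩
    exact SimplyConnectedSpace.ofContractible _
  obtain ⟨l, hl, hlg⟩ := Complex.exists_continuousOn_eqOn_exp_comp hsc isOpen_ball hg
    (by rintro ⟨z, hz, h⟩; exact h0 z hz h)
  refine ⟨fun z => l z + (Complex.log (g x) - l x), hl.add continuousOn_const, ?_, ?_⟩
  · intro z hz
    have h1 : Complex.exp (l x) = g x := hlg hx
    rw [Complex.exp_add, Complex.exp_sub, Complex.exp_log (h0 x hx), h1, div_self (h0 x hx),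
      mul_one]
    exact hlg hz
  · simpa [Complex.log_im] using Complex.abs_arg_le_pi (g x)

open Metric in
theorem norm_log_le_exp_mul {g l : ℂ → ℂ} {R K : ℝ} {B : ℂ → ℝ≥0∞} (hK : 0 ≤ K)
    (hg : ContDiffOn ℝ 2 g (ball 0 R)) (h1 : ∀ z ∈ ball (0 : ℂ) R, ‖g z‖ < 1)
    (hl : ContinuousOn l (ball 0 R)) (hlg : ∀ z ∈ ball (0 : ℂ) R, Complex.exp (l z) = g z)
    (hB : ∀ z ∈ ball (0 : ℂ) R,
      ‖dbar g z‖ₑ ≤ B z * ENNReal.ofReal (‖g z‖ * Real.log (1 / ‖g z‖)))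
    (hpot : ∀ z ∈ ball (0 : ℂ) R, ∫⁻ ζ in ball (0 : ℂ) R, B ζ * ‖ζ - z‖ₑ⁻¹ ≤ ENNReal.ofReal K)
    {z : ℂ} (hz : z ∈ ball (0 : ℂ) R) :
    ‖l z‖ ≤ Real.exp (8 * (Real.pi / 2 + K) * ‖z‖ / (R - ‖z‖) + 2 * K) * ‖l 0‖ ∧
    ‖l 0‖ ≤ Real.exp (8 * (Real.pi / 2 + K) * ‖z‖ / (R - ‖z‖) + 2 * K) * ‖l z‖ := by
  have hzR : ‖z‖ < R := by simpa using hz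
  have hR : 0 < R := (norm_nonneg z).trans_lt hzR
  have h00 : (0 : ℂ) ∈ ball (0 : ℂ) R := by simpa using hR
  have hre : ∀ ζ ∈ ball (0 : ℂ) R, 0 < (-l ζ).re := by
    intro ζ hζ
    have := h1 ζ hζ
    rw [← hlg ζ hζ, Complex.norm_exp, Real.exp_lt_one_iff] at this
    simpa using this
  have hne : ∀ ζ ∈ ball (0 : ℂ) R, -l ζ ≠ 0 := by
    intro ζ hζ h
    have := hre ζ hζ
    rw [h] at this
    simp at this
  set w : ℂ → ℂ := fun ζ => Complex.log (-l ζ) with hw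
  have hlc : ∀ ζ ∈ ball (0 : ℂ) R, ContDiffAt ℝ 2 l ζ := fun ζ hζ =>
    contDiffAt_of_exp_comp (hl.continuousAt (isOpen_ball.mem_nhds hζ))
      (Filter.eventually_of_mem (isOpen_ball.mem_nhds hζ) hlg)
      (hg.contDiffAt (isOpen_ball.mem_nhds hζ))
  have hwc : ∀ ζ ∈ ball (0 : ℂ) R, ContDiffAt ℝ 2 w ζ := by
    intro ζ hζ
    have h2 : ContDiffAt ℝ 2 Complex.log (-l ζ) :=
      (Complex.contDiffAt_log (Or.inl (hre ζ hζ))).restrict_scalars ℝ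
    exact ContDiffAt.comp ζ h2 (hlc ζ hζ).neg
  have hosc : ‖w z - w 0‖ ≤ 8 * (Real.pi / 2 + K) * ‖z‖ / (R - ‖z‖) + 2 * K := by
    refine norm_sub_le_of_abs_im_le (by positivity) hK
      (fun ζ hζ => (hwc ζ hζ).contDiffWithinAt) ?_ ?_ hpot hz
    · intro ζ hζ
      rw [hw, Complex.log_im]
      exact Complex.abs_arg_le_pi_div_two_iff.2 (hre ζ hζ).le
    · intro ζ hζ
      -- The outer function is entire, so the chain rule gives `dbar g = g * l * dbar w`; the factor
      -- `g * l` is then cancelled.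
      have hgw : g =ᶠ[nhds ζ] fun x => Complex.exp (-Complex.exp (w x)) := by
        filter_upwards [isOpen_ball.mem_nhds hζ] with x hx
        rw [hw, Complex.exp_log (hne x hx), neg_neg, hlg x hx]
      have hew : Complex.exp (w ζ) = -l ζ := Complex.exp_log (hne ζ hζ)
      have hder : HasDerivAt (fun x => Complex.exp (-Complex.exp x)) (g ζ * l ζ) (w ζ) := by
        refine ((Complex.hasDerivAt_exp (w ζ)).neg).cexp.congr_deriv ?_
        rw [Pi.neg_apply, hew, neg_neg, hlg ζ hζ]
      have h3 := dbar_holomorphic_comp hder ((hwc ζ hζ).differentiableAt two_ne_zero)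
      rw [← dbar_congr_of_eventuallyEq hgw] at h3
      have h4 := hB ζ hζ
      rw [h3, enorm_mul] at h4
      have h5 : ‖g ζ‖ * Real.log (1 / ‖g ζ‖) ≤ ‖g ζ * l ζ‖ := by
        rw [norm_mul]
        gcongr
        rw [← hlg ζ hζ, Complex.norm_exp, one_div, ← Real.exp_neg, Real.log_exp,
          ← norm_neg (l ζ), ← Complex.neg_re]
        exact Complex.re_le_norm _
      have h6 : ‖g ζ * l ζ‖ₑ ≠ 0 := by
        rw [enorm_ne_zero]
        refine mul_ne_zero ?_ (by simpa using hne ζ hζ)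
        rw [← hlg ζ hζ]; exact Complex.exp_ne_zero _
      have h7 : ‖g ζ * l ζ‖ₑ * ‖dbar w ζ‖ₑ ≤ ‖g ζ * l ζ‖ₑ * B ζ := by
        refine h4.trans ?_
        rw [mul_comm]
        gcongr
        rw [← ofReal_norm]
        exact ENNReal.ofReal_le_ofReal h5
      exact (ENNReal.mul_le_mul_iff_right h6 enorm_ne_top).1 h7
  have hnorm : ∀ ζ ∈ ball (0 : ℂ) R, ‖l ζ‖ = Real.exp (w ζ).re := by
    intro ζ hζ
    rw [← norm_neg, ← Complex.exp_log (hne ζ hζ), Complex.norm_exp]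
  have hre' := abs_le.1 ((Complex.abs_re_le_norm (w z - w 0)).trans hosc)
  rw [Complex.sub_re] at hre'
  rw [hnorm z hz, hnorm 0 h00, ← Real.exp_add, ← Real.exp_add, Real.exp_le_exp, Real.exp_le_exp]
  constructor <;> linarith [hre'.1, hre'.2]

-- Always `log (1/|g|) ≤ |l|`. The reverse, up to `1 + π`, needs a small imaginary part of `l`,
-- available only at one prescribed point: 0 for the first inequality, `z` for the second.
open Metric in
theorem log_inv_norm_le_of_dbar_le {g : ℂ → ℂ} {R K : ℝ} {B : ℂ → ℝ≥0∞} (hK : 0 ≤ K)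
    (hg : ContDiffOn ℝ 2 g (ball 0 R)) (h0 : ∀ z ∈ ball (0 : ℂ) R, g z ≠ 0)
    (h1 : ∀ z ∈ ball (0 : ℂ) R, ‖g z‖ < 1 / Real.exp 1)
    (hB : ∀ z ∈ ball (0 : ℂ) R,
      ‖dbar g z‖ₑ ≤ B z * ENNReal.ofReal (‖g z‖ * Real.log (1 / ‖g z‖)))
    (hpot : ∀ z ∈ ball (0 : ℂ) R, ∫⁻ ζ in ball (0 : ℂ) R, B ζ * ‖ζ - z‖ₑ⁻¹ ≤ ENNReal.ofReal K)
    {z : ℂ} (hz : z ∈ ball (0 : ℂ) R) :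
    Real.log (1 / ‖g z‖) ≤ Real.exp (8 * (Real.pi / 2 + K) * ‖z‖ / (R - ‖z‖) + 2 * K) *
      ((1 + Real.pi) * Real.log (1 / ‖g 0‖)) ∧
    Real.log (1 / ‖g 0‖) ≤ Real.exp (8 * (Real.pi / 2 + K) * ‖z‖ / (R - ‖z‖) + 2 * K) *
      ((1 + Real.pi) * Real.log (1 / ‖g z‖)) := by
  have hzR : ‖z‖ < R := by simpa using hz
  have hR : 0 < R := (norm_nonneg z).trans_lt hzR
  have h00 : (0 : ℂ) ∈ ball (0 : ℂ) R := by simpa using hR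
  have h1' : ∀ z ∈ ball (0 : ℂ) R, ‖g z‖ < 1 := fun z hz => (h1 z hz).trans (by
    rw [one_div, ← Real.exp_neg]; simp)
  have hlog : ∀ {l : ℂ → ℂ} {x : ℂ}, Complex.exp (l x) = g x →
      Real.log (1 / ‖g x‖) = (-l x).re := by
    intro l x h
    rw [← h, Complex.norm_exp, one_div, ← Real.exp_neg, Real.log_exp, Complex.neg_re]
  have hlow : ∀ {l : ℂ → ℂ} {x : ℂ}, Complex.exp (l x) = g x →
      Real.log (1 / ‖g x‖) ≤ ‖l x‖ := by
    intro l x h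
    rw [hlog h, ← norm_neg]
    exact Complex.re_le_norm _
  have hup : ∀ {l : ℂ → ℂ} {x : ℂ}, x ∈ ball (0 : ℂ) R → Complex.exp (l x) = g x →
      |(l x).im| ≤ Real.pi → ‖l x‖ ≤ (1 + Real.pi) * Real.log (1 / ‖g x‖) := by
    intro l x hx h him
    -- This is where `1/e` matters: the real part is at least 1, so an imaginary part of size `π` is
    -- at most `π` times it.
    have h2 : 1 ≤ (-l x).re := by
      have := h1 x hx
      rw [← h, Complex.norm_exp, one_div, ← Real.exp_neg, Real.exp_lt_exp] at this
      rw [Complex.neg_re]; linarith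
    rw [hlog h, ← norm_neg]
    refine (Complex.norm_le_abs_re_add_abs_im _).trans ?_
    rw [abs_of_nonneg (by linarith), Complex.neg_im, abs_neg]
    nlinarith [Real.pi_pos]
  constructor
  · obtain ⟨l, hl, hlg, him⟩ := exists_log_branch hg.continuousOn h0 h00
    have := (norm_log_le_exp_mul hK hg h1' hl hlg hB hpot hz).1
    refine (hlow (hlg z hz)).trans (this.trans ?_)
    gcongr
    exact hup h00 (hlg 0 h00) him
  · obtain ⟨l, hl, hlg, him⟩ := exists_log_branch hg.continuousOn h0 hz
    have := (norm_log_le_exp_mul hK hg h1' hl hlg hB hpot hz).2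
    refine (hlow (hlg 0 h00)).trans (this.trans ?_)
    gcongr
    exact hup hz (hlg z hz) him

/-! ### Bounds for Cauchy potentials. -/

open Metric in
theorem lintegral_norm_rpow_neg_ball_lt_top {q : ℝ} (hq : q < 2) :
    ∫⁻ x in ball (0 : ℂ) 1, ENNReal.ofReal (‖x‖ ^ (-q)) < ∞ := by
  have h : IntegrableOn (fun x : ℂ => ‖x‖ ^ (-q)) (ball 0 1) volume := by
    refine integrableOn_ball_of_norm_le_rpow (C := 1) (α := q) (by simp) (by simpa using hq) ?_
      ((measurable_norm.pow_const _).aestronglyMeasurable)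
    filter_upwards with x
    rw [one_mul, Real.norm_of_nonneg (by positivity)]
  refine lt_of_le_of_lt (lintegral_mono fun x => ?_) h.2
  rw [← Real.enorm_of_nonneg (by positivity)]

-- The kernel is at most 1 at distance at least 1 from `z`, and its `q`-th power is integrable near
-- `z` as `q < 2`; translation invariance makes the bound uniform in `z`.
open Metric in
theorem exists_eLpNorm_inv_norm_sub_le {q : ℝ≥0∞} (h1 : 1 ≤ q) (h2 : q < 2) :
    ∃ C : ℝ≥0, ∀ z : ℂ,
      eLpNorm (fun ζ : ℂ => ‖ζ - z‖⁻¹) q (volume.restrict (ball 0 1)) ≤ C := by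
  have hqt : q ≠ ∞ := (h2.trans (by simp)).ne
  have hq0 : q ≠ 0 := (zero_lt_one.trans_le h1).ne'
  set r : ℝ := q.toReal with hr
  have hr0 : 0 < r := ENNReal.toReal_pos hq0 hqt
  have hr2 : r < 2 := by
    have := (ENNReal.toReal_lt_toReal hqt (by simp)).2 h2
    simpa using this
  set J : ℝ≥0∞ := volume (ball (0 : ℂ) 1) +
    ∫⁻ x in ball (0 : ℂ) 1, ENNReal.ofReal (‖x‖ ^ (-r)) with hJ
  have hJt : J ≠ ∞ :=
    ENNReal.add_ne_top.2 ⟨measure_ball_lt_top.ne, (lintegral_norm_rpow_neg_ball_lt_top hr2).ne⟩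
  have hCt : J ^ (1 / r) ≠ ∞ := ENNReal.rpow_ne_top_of_nonneg (by positivity) hJt
  refine ⟨(J ^ (1 / r)).toNNReal, fun z => ?_⟩
  rw [ENNReal.coe_toNNReal hCt, eLpNorm_eq_lintegral_rpow_enorm_toReal hq0 hqt]
  refine ENNReal.rpow_le_rpow ?_ (by positivity)
  set κ : ℂ → ℝ≥0∞ := (ball (0 : ℂ) 1).indicator fun x => ENNReal.ofReal (‖x‖ ^ (-r)) with hκ
  have hpt : ∀ ζ : ℂ, ‖‖ζ - z‖⁻¹‖ₑ ^ q.toReal ≤ 1 + κ (ζ - z) := by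
    intro ζ
    rw [Real.enorm_of_nonneg (by positivity), ENNReal.ofReal_rpow_of_nonneg (by positivity) hr0.le,
      Real.inv_rpow (norm_nonneg _), ← Real.rpow_neg (norm_nonneg _)]
    by_cases h : ζ - z ∈ ball (0 : ℂ) 1
    · rw [hκ, Set.indicator_of_mem h]
      exact le_add_self
    · refine le_trans ?_ le_self_add
      rw [mem_ball_zero_iff, not_lt] at h
      exact ENNReal.ofReal_le_one.2 (Real.rpow_le_one_of_one_le_of_nonpos h (by linarith))
  calc _ ≤ ∫⁻ ζ in ball (0 : ℂ) 1, (1 + κ (ζ - z)) := lintegral_mono hpt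
    _ = volume (ball (0 : ℂ) 1) + ∫⁻ ζ in ball (0 : ℂ) 1, κ (ζ - z) := by
        rw [lintegral_add_left measurable_const]; simp
    _ ≤ volume (ball (0 : ℂ) 1) + ∫⁻ ζ, κ (ζ - z) := by
        gcongr
        exact Measure.restrict_le_self
    _ = J := by
        rw [lintegral_sub_right_eq_self κ z, hκ, lintegral_indicator measurableSet_ball]

open Metric in
/-- Hölder's inequality bounds the Cauchy potential of an `L^p` function on the disc, `p > 2`. -/
theorem exists_lintegral_mul_inv_le {p : ℝ≥0∞} (hp : 2 < p) :
    ∃ C : ℝ≥0, ∀ (A : ℂ → ℝ), AEStronglyMeasurable A (volume.restrict (ball 0 1)) → ∀ z : ℂ,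
      ∫⁻ ζ in ball (0 : ℂ) 1, ‖A ζ‖ₑ * ‖ζ - z‖ₑ⁻¹ ≤
        eLpNorm A p (volume.restrict (ball 0 1)) * C := by
  have hpinv : p⁻¹ < 2⁻¹ := ENNReal.inv_lt_inv.2 hp
  have hp1 : 1 ≤ p := le_trans (by norm_num) hp.le
  have hpq := ENNReal.HolderConjugate.conjExponent hp1
  set q := p.conjExponent
  have hsum : p⁻¹ + q⁻¹ = 1 := ENNReal.holderConjugate_iff.1 hpq
  have hq1 : 1 ≤ q := by
    rw [← ENNReal.inv_le_one, ← hsum]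
    exact le_add_self
  have hq2 : q < 2 := by
    rw [← ENNReal.inv_lt_inv]
    by_contra h
    have h3 : p⁻¹ + q⁻¹ < 2⁻¹ + 2⁻¹ :=
      ENNReal.add_lt_add_of_lt_of_le (ne_top_of_le_ne_top (by simp) (not_lt.1 h)) hpinv (not_lt.1 h)
    rw [hsum, ENNReal.inv_two_add_inv_two] at h3
    exact lt_irrefl _ h3
  obtain ⟨C, hC⟩ := exists_eLpNorm_inv_norm_sub_le hq1 hq2
  refine ⟨C, fun A hA z => ?_⟩
  have hk : AEStronglyMeasurable (fun ζ : ℂ => ‖ζ - z‖⁻¹) (volume.restrict (ball 0 1)) :=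
    (by fun_prop : Measurable (fun ζ : ℂ => ‖ζ - z‖⁻¹)).aestronglyMeasurable
  have h := eLpNorm_smul_le_mul_eLpNorm (p := p) (q := q) (r := 1) hk hA
  rw [eLpNorm_one_eq_lintegral_enorm] at h
  calc _ = ∫⁻ ζ in ball (0 : ℂ) 1, ‖(A • fun ζ : ℂ => ‖ζ - z‖⁻¹) ζ‖ₑ := by
        refine lintegral_congr_ae (ae_restrict_of_ae ?_)
        filter_upwards [Measure.ae_ne volume z] with ζ hζ
        rw [Pi.smul_apply', enorm_smul, enorm_inv (norm_ne_zero_iff.2 (sub_ne_zero.2 hζ)),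
          enorm_norm]
    _ ≤ _ := h.trans (by gcongr; exact hC z)

/-- The Cauchy potential of a mollification is bounded by the supremum of the Cauchy potential. -/
theorem lintegral_mollification_mul_inv_le {μ : Measure ℂ} [SFinite μ] {a ρ : ℂ → ℝ≥0∞}
    {K : ℝ≥0∞} (ha : AEMeasurable a μ) (hρ : Measurable ρ) (hρ1 : ∫⁻ y, ρ y = 1)
    (hK : ∀ z : ℂ, ∫⁻ ζ, a ζ * ‖ζ - z‖ₑ⁻¹ ∂μ ≤ K) (z₀ : ℂ) :
    ∫⁻ z, (∫⁻ ζ, a ζ * ρ (z - ζ) ∂μ) * ‖z - z₀‖ₑ⁻¹ ≤ K := by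
  have ha1 : AEMeasurable (fun x : ℂ × ℂ => a x.1) (μ.prod volume) := ha.comp_fst
  have ha2 : AEMeasurable (fun x : ℂ × ℂ => a x.2) (volume.prod μ) := ha.comp_snd
  have hen : Measurable (fun z : ℂ => ‖z‖ₑ) := measurable_enorm
  calc _ = ∫⁻ z, ∫⁻ ζ, a ζ * ρ (z - ζ) * ‖z - z₀‖ₑ⁻¹ ∂μ := by
        refine lintegral_congr fun z => ?_
        rw [lintegral_mul_const'']
        exact ha.mul (hρ.comp (measurable_const.sub measurable_id)).aemeasurable
    _ = ∫⁻ ζ, (∫⁻ z, a ζ * ρ (z - ζ) * ‖z - z₀‖ₑ⁻¹) ∂μ := by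
        refine lintegral_lintegral_swap ?_
        refine (ha2.mul (Measurable.aemeasurable ?_)).mul (Measurable.aemeasurable ?_)
        · exact hρ.comp (measurable_fst.sub measurable_snd)
        · exact (hen.comp (measurable_fst.sub_const z₀)).inv
    -- Substituting `y = z - ζ` moves the pole to `z₀ - y`, so for fixed `y` the assumed bound
    -- applies there.
    _ = ∫⁻ ζ, (∫⁻ y, a ζ * ρ y * ‖ζ - (z₀ - y)‖ₑ⁻¹) ∂μ := by
        refine lintegral_congr fun ζ => ?_
        rw [← lintegral_sub_right_eq_self (fun y => a ζ * ρ y * ‖ζ - (z₀ - y)‖ₑ⁻¹) ζ]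
        refine lintegral_congr fun z => ?_
        rw [show ζ - (z₀ - (z - ζ)) = z - z₀ by ring]
    _ = ∫⁻ y, (∫⁻ ζ, a ζ * ρ y * ‖ζ - (z₀ - y)‖ₑ⁻¹ ∂μ) := by
        refine lintegral_lintegral_swap ?_
        refine (ha1.mul (Measurable.aemeasurable ?_)).mul (Measurable.aemeasurable ?_)
        · exact hρ.comp measurable_snd
        · exact (hen.comp (measurable_fst.sub (measurable_snd.const_sub z₀))).inv
    _ ≤ ∫⁻ y, ρ y * K := by
        refine lintegral_mono fun y => ?_
        calc _ = ∫⁻ ζ, ρ y * (a ζ * ‖ζ - (z₀ - y)‖ₑ⁻¹) ∂μ := by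
              refine lintegral_congr fun ζ => ?_
              ring
          _ = ρ y * ∫⁻ ζ, a ζ * ‖ζ - (z₀ - y)‖ₑ⁻¹ ∂μ := by
              refine lintegral_const_mul'' _ (ha.mul (Measurable.aemeasurable ?_))
              exact (hen.comp (measurable_id.sub_const _)).inv
          _ ≤ _ := by gcongr; exact hK _
    _ = K := by rw [lintegral_mul_const _ hρ, hρ1, one_mul]

/-! ### Mollification and passage to the limit. -/

open Metric in
open scoped Convolution in
/-- The mollification of a function on the unit disc, extended by zero. -/
noncomputable def mollify (φ : ContDiffBump (0 : ℂ)) (f : ℂ → ℂ) : ℂ → ℂ :=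
  (ball (0 : ℂ) 1).indicator f ⋆[ContinuousLinearMap.mul ℝ ℂ, volume]
    fun x => (φ.normed volume x : ℂ)

theorem contDiff_ofReal_normed (φ : ContDiffBump (0 : ℂ)) :
    ContDiff ℝ (⊤ : ℕ∞) fun x => (φ.normed volume x : ℂ) :=
  Complex.ofRealCLM.contDiff.comp φ.contDiff_normed

theorem hasCompactSupport_ofReal_normed (φ : ContDiffBump (0 : ℂ)) :
    HasCompactSupport fun x => (φ.normed volume x : ℂ) :=
  φ.hasCompactSupport_normed.comp_left (g := fun x : ℝ => (x : ℂ)) Complex.ofReal_zero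

open Metric in
theorem locallyIntegrable_indicator {f : ℂ → ℂ} {C : ℝ} (hf : ContinuousOn f (ball 0 1))
    (hC : ∀ z ∈ ball (0 : ℂ) 1, ‖f z‖ ≤ C) :
    LocallyIntegrable ((ball (0 : ℂ) 1).indicator f) volume := by
  refine Integrable.locallyIntegrable ?_
  rw [integrable_indicator_iff measurableSet_ball]
  refine ⟨hf.aestronglyMeasurable measurableSet_ball, ?_⟩
  exact HasFiniteIntegral.restrict_of_bounded C measure_ball_lt_top
    ((ae_restrict_iff' measurableSet_ball).2 (.of_forall hC))

theorem contDiff_mollify (φ : ContDiffBump (0 : ℂ)) {f : ℂ → ℂ}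
    (hf : LocallyIntegrable ((Metric.ball (0 : ℂ) 1).indicator f) volume) :
    ContDiff ℝ (⊤ : ℕ∞) (mollify φ f) :=
  (hasCompactSupport_ofReal_normed φ).contDiff_convolution_right (ContinuousLinearMap.mul ℝ ℂ) hf
    (contDiff_ofReal_normed φ)

open Metric in
open scoped Convolution in
theorem norm_mollify_sub_le (φ : ContDiffBump (0 : ℂ)) {f : ℂ → ℂ} {z : ℂ} {ε : ℝ}
    (hf : LocallyIntegrable ((ball (0 : ℂ) 1).indicator f) volume)
    (hz : ball z φ.rOut ⊆ ball 0 1) (hε : ∀ ζ ∈ ball z φ.rOut, ‖f ζ - f z‖ ≤ ε) :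
    ‖mollify φ f z - f z‖ ≤ ε := by
  have hzz : z ∈ ball (0 : ℂ) 1 := hz (mem_ball_self φ.rOut_pos)
  have h := φ.dist_normed_convolution_le (μ := volume) (x₀ := z) (ε := ε)
    hf.aestronglyMeasurable (by
      intro x hx
      rw [Set.indicator_of_mem (hz hx), Set.indicator_of_mem hzz, dist_eq_norm]
      exact hε x hx)
  rw [Set.indicator_of_mem hzz, dist_eq_norm] at h
  have he : mollify φ f z = (φ.normed volume ⋆[ContinuousLinearMap.lsmul ℝ ℝ, volume]
      (ball (0 : ℂ) 1).indicator f) z := by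
    rw [convolution_lsmul_swap, mollify, MeasureTheory.convolution]
    congr 1
    funext t
    simp [mul_comm]
  rw [he]
  exact h

-- Test the distributional identity against the translated, reflected bump, whose support lies in
-- the disc.
open Metric in
theorem enorm_dbar_mollify_le (φ : ContDiffBump (0 : ℂ)) {f g : ℂ → ℂ} {z : ℂ}
    (hf : LocallyIntegrable ((ball (0 : ℂ) 1).indicator f) volume)
    (hfg : HasDistribDbarOn f g (ball 0 1)) (hz : closedBall z φ.rOut ⊆ ball 0 1) :
    ‖dbar (mollify φ f) z‖ₑ ≤
      ∫⁻ ζ in ball (0 : ℂ) 1, ‖g ζ‖ₑ * ENNReal.ofReal (φ.normed volume (z - ζ)) := by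
  set ρ : ℂ → ℂ := fun x => (φ.normed volume x : ℂ) with hρ
  have hρc : ContDiff ℝ (⊤ : ℕ∞) ρ := contDiff_ofReal_normed φ
  have hρs : HasCompactSupport ρ := hasCompactSupport_ofReal_normed φ
  have hρ1 : ContDiff ℝ 1 ρ := hρc.of_le (by exact_mod_cast le_top)
  have h := hfg.integral_eq (fun t => ρ (z - t)) (hρc.comp (contDiff_const.sub contDiff_id))
    (hρs.comp_homeomorph (Homeomorph.subLeft z)) (by
      refine subset_trans (closure_minimal ?_ isClosed_closedBall) hz
      intro t ht
      have h1 : φ.normed volume (z - t) ≠ 0 := by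
        simpa [hρ] using ht
      have h2 : z - t ∈ Function.support (φ.normed volume) := h1
      rw [φ.support_normed_eq, mem_ball_zero_iff] at h2
      rw [mem_closedBall, dist_comm, dist_eq_norm]
      exact h2.le)
  simp only [dbar_comp_sub_left (hρ1.differentiable one_ne_zero), mul_neg, integral_neg,
    neg_inj] at h
  have h3 : dbar (mollify φ f) z = ∫ t in ball (0 : ℂ) 1, g t * ρ (z - t) := by
    rw [← h, mollify, dbar_convolution hf hρ1 hρs, ← integral_indicator measurableSet_ball]
    congr 1
    funext t
    by_cases ht : t ∈ ball (0 : ℂ) 1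
    · simp [Set.indicator_of_mem ht]
    · simp [Set.indicator_of_notMem ht]
  rw [h3]
  refine (enorm_integral_le_lintegral_enorm _).trans (le_of_eq ?_)
  refine lintegral_congr fun t => ?_
  rw [enorm_mul, hρ]
  congr 1
  rw [← ofReal_norm, Complex.norm_real, Real.norm_of_nonneg (φ.nonneg_normed _)]

open Metric in
/-- On a smaller disc, a continuous function with values in the punctured disc of radius `1/e` is
stable under small perturbations, together with `‖f‖ log (1/‖f‖)` up to a factor. -/
theorem exists_perturbation_radius {f : ℂ → ℂ} {S : Set ℂ} (hS : IsCompact S)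
    (hf : ContinuousOn f S) (h0 : ∀ z ∈ S, f z ≠ 0) (h1 : ∀ z ∈ S, ‖f z‖ < 1 / Real.exp 1) :
    ∃ δ > 0, ∀ z ∈ S, ∀ v : ℂ, ‖v - f z‖ < δ → v ≠ 0 ∧ ‖v‖ < 1 / Real.exp 1 ∧
      3 * |‖v‖ * Real.log (1 / ‖v‖) - ‖f z‖ * Real.log (1 / ‖f z‖)| ≤
        ‖f z‖ * Real.log (1 / ‖f z‖) := by
  rcases S.eq_empty_or_nonempty with rfl | hne
  · exact ⟨1, one_pos, by simp⟩
  have he : 1 / Real.exp 1 < 1 := by rw [one_div, ← Real.exp_neg]; simp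
  have hψ : ∀ x : ℝ, x * Real.log (1 / x) = Real.negMulLog x := by
    intro x; rw [one_div, Real.log_inv, Real.negMulLog]; ring
  simp only [hψ]
  obtain ⟨a, ha, hamin⟩ := hS.exists_isMinOn hne hf.norm
  obtain ⟨b, hb, hbmax⟩ := hS.exists_isMaxOn hne hf.norm
  obtain ⟨c, hc, hcmin⟩ := hS.exists_isMinOn hne (Real.continuous_negMulLog.comp_continuousOn hf.norm)
  have ha0 : 0 < ‖f a‖ := norm_pos_iff.2 (h0 a ha)
  have hc0 : 0 < Real.negMulLog ‖f c‖ := by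
    have h2 : 0 < ‖f c‖ := norm_pos_iff.2 (h0 c hc)
    rw [Real.negMulLog, neg_mul, neg_pos]
    exact mul_neg_of_pos_of_neg h2 (Real.log_neg h2 ((h1 c hc).trans he))
  have huc : UniformContinuousOn Real.negMulLog (Set.Icc 0 1) :=
    isCompact_Icc.uniformContinuousOn_of_continuous Real.continuous_negMulLog.continuousOn
  obtain ⟨δ₁, hδ₁, huc⟩ := Metric.uniformContinuousOn_iff.1 huc (Real.negMulLog ‖f c‖ / 3)
    (by positivity)
  refine ⟨min δ₁ (min ‖f a‖ (1 / Real.exp 1 - ‖f b‖)),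
    lt_min hδ₁ (lt_min ha0 (sub_pos.2 (h1 b hb))), ?_⟩
  intro z hz v hv
  obtain ⟨hv1, hv⟩ := lt_min_iff.1 hv
  obtain ⟨hv2, hv3⟩ := lt_min_iff.1 hv
  have hd : |‖v‖ - ‖f z‖| ≤ ‖v - f z‖ := abs_norm_sub_norm_le _ _
  have hd' := abs_le.1 hd
  have haz : ‖f a‖ ≤ ‖f z‖ := hamin hz
  have hbz : ‖f z‖ ≤ ‖f b‖ := hbmax hz
  have hcz : Real.negMulLog ‖f c‖ ≤ Real.negMulLog ‖f z‖ := hcmin hz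
  have hve : ‖v‖ < 1 / Real.exp 1 := by linarith
  refine ⟨norm_pos_iff.1 (by linarith), hve, ?_⟩
  have h5 := huc ‖v‖ ⟨norm_nonneg _, (hve.trans he).le⟩ ‖f z‖
    ⟨norm_nonneg _, ((h1 z hz).trans he).le⟩ (by
      rw [Real.dist_eq]; exact hd.trans_lt hv1)
  rw [Real.dist_eq] at h5
  linarith

theorem lintegral_normed_eq_one (φ : ContDiffBump (0 : ℂ)) :
    ∫⁻ y, ENNReal.ofReal (φ.normed volume y) = 1 := by
  rw [← ofReal_integral_eq_lintegral_ofReal φ.integrable_normed (.of_forall φ.nonneg_normed),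
    φ.integral_normed, ENNReal.ofReal_one]

open Metric in
/-- The comparison estimate on a smaller disc for values arbitrarily close to `f z` and `f 0`. -/
theorem exists_approx_log_inv_norm_le {f g : ℂ → ℂ} {A : ℂ → ℝ} {R K η : ℝ} (hK : 0 ≤ K)
    (hR : R < 1) (hη : 0 < η) (hf : ContinuousOn f (ball 0 1))
    (h0 : ∀ z ∈ ball (0 : ℂ) 1, f z ≠ 0)
    (h1 : ∀ z ∈ ball (0 : ℂ) 1, ‖f z‖ < 1 / Real.exp 1)
    (hfg : HasDistribDbarOn f g (ball 0 1))
    (hAm : AEStronglyMeasurable A (volume.restrict (ball 0 1)))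
    (hA : ∀ᵐ z ∂(volume.restrict (ball (0 : ℂ) 1)),
        ‖g z‖ ≤ A z * ‖f z‖ * Real.log (1 / ‖f z‖))
    (hpot : ∀ z : ℂ, ∫⁻ ζ in ball (0 : ℂ) 1, ‖A ζ‖ₑ * ‖ζ - z‖ₑ⁻¹ ≤ ENNReal.ofReal K)
    {z : ℂ} (hz : z ∈ ball (0 : ℂ) R) :
    ∃ a b : ℂ, ‖a - f z‖ < η ∧ ‖b - f 0‖ < η ∧
      Real.log (1 / ‖a‖) ≤ Real.exp (8 * (Real.pi / 2 + 2 * K) * ‖z‖ / (R - ‖z‖) + 2 * (2 * K)) *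
        ((1 + Real.pi) * Real.log (1 / ‖b‖)) ∧
      Real.log (1 / ‖b‖) ≤ Real.exp (8 * (Real.pi / 2 + 2 * K) * ‖z‖ / (R - ‖z‖) + 2 * (2 * K)) *
        ((1 + Real.pi) * Real.log (1 / ‖a‖)) := by
  have hzR : ‖z‖ < R := by simpa using hz
  have hR0 : 0 < R := (norm_nonneg z).trans_lt hzR
  set R' : ℝ := (1 + R) / 2 with hR'
  have hS : closedBall (0 : ℂ) R' ⊆ ball 0 1 := closedBall_subset_ball (by linarith)
  have hSc : IsCompact (closedBall (0 : ℂ) R') := isCompact_closedBall _ _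
  obtain ⟨δ, hδ, hpert⟩ := exists_perturbation_radius hSc (hf.mono hS)
    (fun z hz => h0 z (hS hz)) (fun z hz => h1 z (hS hz))
  obtain ⟨ε₀, hε₀, huc⟩ := Metric.uniformContinuousOn_iff.1
    (hSc.uniformContinuousOn_of_continuous (hf.mono hS)) (min δ η / 2) (by positivity)
  set ε : ℝ := min ε₀ ((1 - R) / 2) with hε
  have hε0 : 0 < ε := lt_min hε₀ (by linarith)
  let φ : ContDiffBump (0 : ℂ) := ⟨ε / 2, ε, by positivity, by linarith⟩
  have hrOut : φ.rOut = ε := rfl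
  have hsub : ∀ x ∈ ball (0 : ℂ) R, closedBall x φ.rOut ⊆ closedBall 0 R' := by
    intro x hx
    refine closedBall_subset_closedBall' ?_
    have h2 : dist x 0 < R := hx
    have h3 : ε ≤ (1 - R) / 2 := min_le_right _ _
    rw [hrOut]; linarith
  have hself : ∀ x ∈ ball (0 : ℂ) R, x ∈ closedBall (0 : ℂ) R' := fun x hx =>
    hsub x hx (mem_closedBall_self φ.rOut_pos.le)
  have hclose : ∀ x ∈ ball (0 : ℂ) R, ∀ ζ ∈ ball x φ.rOut, ‖f ζ - f x‖ < min δ η / 2 := by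
    intro x hx ζ hζ
    rw [← dist_eq_norm]
    refine huc ζ (hsub x hx (ball_subset_closedBall hζ)) x (hself x hx) ?_
    exact lt_of_lt_of_le hζ (min_le_left _ _)
  have hloc : LocallyIntegrable ((ball (0 : ℂ) 1).indicator f) volume :=
    locallyIntegrable_indicator hf (fun z hz => (h1 z hz).le)
  set m := mollify φ f with hm
  have hmc : ContDiff ℝ (⊤ : ℕ∞) m := contDiff_mollify φ hloc
  have hmf : ∀ x ∈ ball (0 : ℂ) R, ‖m x - f x‖ < min δ η := by
    intro x hx
    refine lt_of_le_of_lt (norm_mollify_sub_le φ hloc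
      ((ball_subset_closedBall.trans (hsub x hx)).trans hS) fun ζ hζ => (hclose x hx ζ hζ).le) ?_
    exact half_lt_self (by positivity)
  have hmp := fun x hx => hpert x (hself x hx) (m x) ((hmf x hx).trans_le (min_le_left _ _))
  -- Both quantities differ from their value for `f x` by at most a third of it, so their ratio is
  -- at most `(4/3)/(2/3) = 2`.
  have hψ : ∀ x ∈ ball (0 : ℂ) R, ∀ ζ ∈ ball x φ.rOut,
      ‖f ζ‖ * Real.log (1 / ‖f ζ‖) ≤ 2 * (‖m x‖ * Real.log (1 / ‖m x‖)) := by
    intro x hx ζ hζ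
    have e1 := (hmp x hx).2.2
    have e2 := (hpert x (hself x hx) (f ζ) ((hclose x hx ζ hζ).trans_le
      ((half_le_self (by positivity)).trans (min_le_left _ _)))).2.2
    have e3 := neg_le_abs (‖m x‖ * Real.log (1 / ‖m x‖) - ‖f x‖ * Real.log (1 / ‖f x‖))
    have e4 := le_abs_self (‖f ζ‖ * Real.log (1 / ‖f ζ‖) - ‖f x‖ * Real.log (1 / ‖f x‖))
    linarith
  set ρ : ℂ → ℝ≥0∞ := fun y => ENNReal.ofReal (φ.normed volume y) with hρ
  have hρm : Measurable ρ := φ.continuous_normed.measurable.ennreal_ofReal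
  set B : ℂ → ℝ≥0∞ := fun x => 2 * ∫⁻ ζ in ball (0 : ℂ) 1, ‖A ζ‖ₑ * ρ (x - ζ) with hB
  have hAe : AEMeasurable (fun ζ => ‖A ζ‖ₑ) (volume.restrict (ball (0 : ℂ) 1)) := hAm.enorm
  have hdbar : ∀ x ∈ ball (0 : ℂ) R,
      ‖dbar m x‖ₑ ≤ B x * ENNReal.ofReal (‖m x‖ * Real.log (1 / ‖m x‖)) := by
    intro x hx
    refine (enorm_dbar_mollify_le φ hloc hfg ((hsub x hx).trans hS)).trans ?_
    have hm1 : AEMeasurable (fun ζ => ‖A ζ‖ₑ * ρ (x - ζ)) (volume.restrict (ball (0 : ℂ) 1)) :=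
      hAe.mul (hρm.comp (measurable_const.sub measurable_id)).aemeasurable
    rw [hB]
    calc _ ≤ ∫⁻ ζ in ball (0 : ℂ) 1, (‖A ζ‖ₑ * ρ (x - ζ)) *
          ENNReal.ofReal (2 * (‖m x‖ * Real.log (1 / ‖m x‖))) := by
          refine lintegral_mono_ae ?_
          filter_upwards [hA, ae_restrict_mem measurableSet_ball] with ζ hζ hζ1
          by_cases hζx : ζ ∈ ball x φ.rOut
          · rw [mul_right_comm]
            gcongr
            rw [← ofReal_norm, ← ofReal_norm, ← ENNReal.ofReal_mul (norm_nonneg _)]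
            refine ENNReal.ofReal_le_ofReal (hζ.trans ?_)
            have hfz : 0 ≤ ‖f ζ‖ * Real.log (1 / ‖f ζ‖) := by
              refine mul_nonneg (norm_nonneg _) (Real.log_nonneg ?_)
              rw [le_div_iff₀ (norm_pos_iff.2 (h0 ζ hζ1)), one_mul]
              refine (h1 ζ hζ1).le.trans ?_
              rw [one_div, ← Real.exp_neg]; simp
            rw [mul_assoc]
            exact mul_le_mul (Real.le_norm_self _) (hψ x hx ζ hζx) hfz (norm_nonneg _)
          · have : φ.normed volume (x - ζ) = 0 := by
              by_contra h
              have h2 : x - ζ ∈ Function.support (φ.normed volume) := h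
              rw [φ.support_normed_eq, mem_ball_zero_iff, ← dist_eq_norm, dist_comm] at h2
              exact hζx h2
            rw [this]; simp
      _ = _ := by
          rw [lintegral_mul_const'' _ hm1, ENNReal.ofReal_mul zero_le_two, ENNReal.ofReal_ofNat]
          ring
  have hpotB : ∀ x ∈ ball (0 : ℂ) R,
      ∫⁻ ζ in ball (0 : ℂ) R, B ζ * ‖ζ - x‖ₑ⁻¹ ≤ ENNReal.ofReal (2 * K) := by
    intro x _
    have h3 := lintegral_mollification_mul_inv_le hAe hρm (lintegral_normed_eq_one φ) hpot x
    rw [ENNReal.ofReal_mul zero_le_two, ENNReal.ofReal_ofNat]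
    refine (lintegral_mono' Measure.restrict_le_self le_rfl).trans ?_
    simp only [hB, mul_assoc]
    rw [lintegral_const_mul' _ _ (by simp)]
    gcongr
  have hfin := log_inv_norm_le_of_dbar_le (K := 2 * K) (by positivity)
    (hmc.of_le (WithTop.coe_le_coe.2 le_top)).contDiffOn (fun x hx => (hmp x hx).1)
    (fun x hx => (hmp x hx).2.1) hdbar hpotB hz
  have h00 : (0 : ℂ) ∈ ball (0 : ℂ) R := by simpa using hR0
  exact ⟨m z, m 0, (hmf z hz).trans_le (min_le_right _ _), (hmf 0 h00).trans_le (min_le_right _ _),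
    hfin⟩

-- The approximate comparison has constants independent of `η`, so `η = 1/(n+1)` can tend to zero.
open Metric Filter in
theorem log_inv_norm_le_of_distribDbar_le {f g : ℂ → ℂ} {A : ℂ → ℝ} {R K : ℝ} (hK : 0 ≤ K)
    (hR : R < 1) (hf : ContinuousOn f (ball 0 1))
    (h0 : ∀ z ∈ ball (0 : ℂ) 1, f z ≠ 0)
    (h1 : ∀ z ∈ ball (0 : ℂ) 1, ‖f z‖ < 1 / Real.exp 1)
    (hfg : HasDistribDbarOn f g (ball 0 1))
    (hAm : AEStronglyMeasurable A (volume.restrict (ball 0 1)))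
    (hA : ∀ᵐ z ∂(volume.restrict (ball (0 : ℂ) 1)),
        ‖g z‖ ≤ A z * ‖f z‖ * Real.log (1 / ‖f z‖))
    (hpot : ∀ z : ℂ, ∫⁻ ζ in ball (0 : ℂ) 1, ‖A ζ‖ₑ * ‖ζ - z‖ₑ⁻¹ ≤ ENNReal.ofReal K)
    {z : ℂ} (hz : z ∈ ball (0 : ℂ) R) :
    Real.log (1 / ‖f z‖) ≤
      Real.exp (8 * (Real.pi / 2 + 2 * K) * ‖z‖ / (R - ‖z‖) + 2 * (2 * K)) *
        ((1 + Real.pi) * Real.log (1 / ‖f 0‖)) ∧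
    Real.log (1 / ‖f 0‖) ≤
      Real.exp (8 * (Real.pi / 2 + 2 * K) * ‖z‖ / (R - ‖z‖) + 2 * (2 * K)) *
        ((1 + Real.pi) * Real.log (1 / ‖f z‖)) := by
  choose a b ha hb hab hba using fun n : ℕ => exists_approx_log_inv_norm_le hK hR
    (Nat.one_div_pos_of_nat (n := n) (α := ℝ)) hf h0 h1 hfg hAm hA hpot hz
  have hlim : ∀ {u : ℕ → ℂ} {x : ℂ}, x ∈ ball (0 : ℂ) 1 →
      (∀ n : ℕ, ‖u n - f x‖ < 1 / ((n : ℝ) + 1)) →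
      Tendsto (fun n => Real.log (1 / ‖u n‖)) atTop (nhds (Real.log (1 / ‖f x‖))) := by
    intro u x hx hu
    have h2 : Tendsto u atTop (nhds (f x)) := by
      rw [tendsto_iff_norm_sub_tendsto_zero]
      exact squeeze_zero (fun _ => norm_nonneg _) (fun n => (hu n).le)
        tendsto_one_div_add_atTop_nhds_zero_nat
    have h3 : ‖f x‖ ≠ 0 := norm_ne_zero_iff.2 (h0 x hx)
    exact (tendsto_const_nhds.div h2.norm h3).log (by simpa using h0 x hx)
  have hza : z ∈ ball (0 : ℂ) 1 := ball_subset_ball hR.le hz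
  have hla := hlim hza ha
  have hlb := hlim (mem_ball_self one_pos) hb
  exact ⟨le_of_tendsto_of_tendsto' hla ((hlb.const_mul _).const_mul _) hab,
    le_of_tendsto_of_tendsto' hlb ((hla.const_mul _).const_mul _) hba⟩

theorem proposition5 (p : ℝ≥0∞) (hp : 2 < p) (N : ℝ≥0) :
    ∃ c : ℝ, ∀ (f fzbar : ℂ → ℂ) (A : ℂ → ℝ),
      ContinuousOn f (Metric.ball 0 1) →
      (∀ z ∈ Metric.ball (0 : ℂ) 1, f z ≠ 0) →
      (∀ z ∈ Metric.ball (0 : ℂ) 1, ‖f z‖ < 1 / Real.exp 1) →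
      HasDistribDbarOn f fzbar (Metric.ball 0 1) →
      MemLp A p (volume.restrict (Metric.ball 0 1)) →
      eLpNorm A p (volume.restrict (Metric.ball 0 1)) = N →
      (∀ᵐ z ∂(volume.restrict (Metric.ball (0 : ℂ) 1)),
        ‖fzbar z‖ ≤ A z * ‖f z‖ * Real.log (1 / ‖f z‖)) →
      ∀ z ∈ Metric.ball (0 : ℂ) 1,
        Real.exp (-(c / (1 - ‖z‖) ^ (2 - (2 / p).toReal))) ≤
            Real.log (1 / ‖f z‖) / Real.log (1 / ‖f 0‖) ∧
          Real.log (1 / ‖f z‖) / Real.log (1 / ‖f 0‖) ≤ Real.exp (c / (1 - ‖z‖)) := by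
  obtain ⟨C, hC⟩ := exists_lintegral_mul_inv_le hp
  set K : ℝ := N * C with hKdef
  have hK : 0 ≤ K := by positivity
  -- With `R = (1 + ‖z‖)/2` below, `R - ‖z‖` is half of `1 - ‖z‖`, so 8 becomes 16. The other terms
  -- are the additive `4K` and the prefactor `1 + π`, absorbed using `1 - ‖z‖ ≤ 1`.
  set c : ℝ := 16 * (Real.pi / 2 + 2 * K) + 4 * K + Real.log (1 + Real.pi) with hc
  have hlogπ : 0 ≤ Real.log (1 + Real.pi) := Real.log_nonneg (by linarith [Real.pi_pos])
  have hc0 : 0 ≤ c := by positivity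
  refine ⟨c, ?_⟩
  intro f g A hf h0 h1 hfg hAp hAN hA z hz
  have hz1 : ‖z‖ < 1 := by simpa using hz
  have hd : 0 < 1 - ‖z‖ := by linarith
  have hd1 : 1 - ‖z‖ ≤ 1 := by linarith [norm_nonneg z]
  have hpot : ∀ x : ℂ, ∫⁻ ζ in Metric.ball (0 : ℂ) 1, ‖A ζ‖ₑ * ‖ζ - x‖ₑ⁻¹ ≤ ENNReal.ofReal K := by
    intro x
    refine (hC A hAp.1 x).trans (le_of_eq ?_)
    rw [hAN, hKdef, ENNReal.ofReal_mul (by positivity), ENNReal.ofReal_coe_nnreal,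
      ENNReal.ofReal_coe_nnreal]
  have hmain := log_inv_norm_le_of_distribDbar_le (R := (1 + ‖z‖) / 2) hK (by linarith) hf h0 h1
    hfg hAp.1 hA hpot (z := z) (by rw [mem_ball_zero_iff]; linarith)
  have hexp : Real.exp (8 * (Real.pi / 2 + 2 * K) * ‖z‖ / ((1 + ‖z‖) / 2 - ‖z‖) + 2 * (2 * K)) *
      (1 + Real.pi) ≤ Real.exp (c / (1 - ‖z‖)) := by
    have h3 : 0 < 1 + Real.pi := by positivity
    rw [← le_div_iff₀ h3, ← Real.exp_log h3, ← Real.exp_sub, Real.exp_le_exp, le_sub_iff_add_le,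
      show (1 + ‖z‖) / 2 - ‖z‖ = (1 - ‖z‖) / 2 by ring, le_div_iff₀ hd, add_mul, add_mul,
      div_mul_eq_mul_div, div_div_eq_mul_div, mul_right_comm _ (1 - ‖z‖),
      mul_div_cancel_right₀ _ hd.ne']
    have h2 : 0 ≤ Real.pi / 2 + 2 * K := by positivity
    nlinarith [mul_le_mul_of_nonneg_left hz1.le h2, mul_nonneg hK (norm_nonneg z),
      mul_nonneg hlogπ (norm_nonneg z)]
  have hpos : ∀ x ∈ Metric.ball (0 : ℂ) 1, 0 < Real.log (1 / ‖f x‖) := by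
    intro x hx
    have h2 : 0 < ‖f x‖ := norm_pos_iff.2 (h0 x hx)
    refine Real.log_pos ?_
    rw [lt_div_iff₀ h2, one_mul]
    refine (h1 x hx).trans ?_
    rw [one_div, ← Real.exp_neg]; simp
  have hz0 := hpos z hz
  have h00 := hpos 0 (Metric.mem_ball_self one_pos)
  simp only [← mul_assoc] at hmain hexp
  constructor
  · have h2 : Real.exp (-(c / (1 - ‖z‖))) ≤ Real.log (1 / ‖f z‖) / Real.log (1 / ‖f 0‖) := by
      rw [le_div_iff₀ h00, Real.exp_neg, inv_mul_le_iff₀ (Real.exp_pos _)]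
      exact hmain.2.trans (by gcongr)
    -- The exponent `2 - 2/p` is at least 1 and the base at most 1, so the bound with exponent 1
    -- suffices.
    refine le_trans (Real.exp_le_exp.2 (neg_le_neg ?_)) h2
    have hs : (2 / p).toReal ≤ 1 := by
      refine ENNReal.toReal_le_of_le_ofReal zero_le_one ?_
      rw [ENNReal.ofReal_one]
      exact ENNReal.div_le_of_le_mul (by rw [one_mul]; exact hp.le)
    have hpow : (1 - ‖z‖) ^ (2 - (2 / p).toReal) ≤ 1 - ‖z‖ := by
      conv_rhs => rw [← Real.rpow_one (1 - ‖z‖)]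
      exact Real.rpow_le_rpow_of_exponent_ge hd hd1 (by linarith)
    have := Real.rpow_pos_of_pos hd (2 - (2 / p).toReal)
    gcongr
  · rw [div_le_iff₀ h00]
    exact hmain.1.trans (by gcongr)
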